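/- Functions of three-valued logic are maps $f(x_{i_1},\ldots,x_{i_n}):\{0,1,2\}^n\to\{0,1,2\}$, $n\ge 1$, in finitely many distinct variables from a countable alphabet. Two functions are congruent if one is obtained from the other by renaming variables without identifying them. Let $R$ be the set of all functions that take only the values $0$ and $1$ and equal $0$ on every tuple having at least one component $0$. For $f(x_{i_1},\ldots,x_{i_n})\in R$ put $N_f=\{\alpha\in\{0,1,2\}^n: f(\alpha)=1\}$, and for $e,d\ge 0$ with $e+d=n$ let $\mathcal L(e,d)$ be the set of tuples in $\{1,2\}^n$ with exactly $e$ ones and $d$ twos. Let $S_{-1}$ be the set of all $f\in R$ such that $N_f=\{1,2\}^n\setminus\mathcal L(e,d)$ for some such $e,d$. A formula over a set $F$ of functions is an expression $g(B_1,\ldots,B_m)$ with $g\in F$, where each $B_i$ is a variable or a formula over $F$; $[F]$ denotes the set of all functions realized by formulas over $F$ (the variables of the realized function being those that occur in the formula). A basis of a class $G=[F]$ is a subset $\mathfrak A\subseteq G$ with $[\mathfrak A]=G$ such that $[\mathfrak A']\ne G$ for every proper subset $\mathfrak A'\subsetneq\mathfrak A$. Theorem 2. Let $F\subseteq S_{-1}$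 contain no two distinct congruent functions, and let $G=[F]$. Then 1. $G$ has a finite basis if and only if $F$ is finite; 2. $G$ has no basis at all (finite or infinite) if and only if $F$ is infinite. -/

import Mathlib

namespace ThreeValued

/-- A function of three-valued logic: a map `{0,1,2}^V → {0,1,2}`, where `V` is its finite
non-empty set of variables, taken from the countable alphabet `x₀, x₁, x₂, …`
(the variable `xᵢ` is represented by its index `i`). -/
structure Fn where
  vars : Finset ℕ
  vars_nonempty : vars.Nonempty
  toFun : (vars → Fin 3) → Fin 3

/-- Two functions are congruent if one is obtained from the other by renaming variables
without identifying any of them. -/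
def Congruent (f g : Fn) : Prop :=
  ∃ σ : f.vars ≃ g.vars, ∀ α : g.vars → Fin 3, g.toFun α = f.toFun (fun i => α (σ i))

/-- The set of tuples `{1,2}^V`. -/
def cube (V : Finset ℕ) : Set (V → Fin 3) := {α | ∀ i, α i = 1 ∨ α i = 2}

/-- The layer of all tuples from `{1,2}^V` with exactly `e` ones and exactly `d` twos. -/
def layer (V : Finset ℕ) (e d : ℕ) : Set (V → Fin 3) :=
  {α | α ∈ cube V ∧
    (Finset.univ.filter fun i => α i = 1).card = e ∧
    (Finset.univ.filter fun i => α i = 2).card = d}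

/-- `N_f`, the set of tuples on which `f` equals `1`. -/
def Fn.ones (f : Fn) : Set (f.vars → Fin 3) := {α | f.toFun α = 1}

/-- `R`: the functions with values in `{0,1}` that vanish on every tuple with a zero component. -/
def R : Set Fn :=
  {f | (∀ α, f.toFun α = 0 ∨ f.toFun α = 1) ∧ ∀ α, α ∉ cube f.vars → f.toFun α = 0}

/-- `S₋₁`: the functions of `R` that equal `1` exactly on `{1,2}^n` without one layer. -/
def SMinusOne : Set Fn :=
  {f | f ∈ R ∧ ∃ e d : ℕ, e + d = f.vars.card ∧
    f.ones = cube f.vars \ layer f.vars e d}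

/-- Terms over a set `F` of functions: variables, and expressions `g(B₁, …, Bₘ)` with `g ∈ F`
whose arguments `Bᵢ` (one for each variable of `g`) are terms again. -/
inductive Term (F : Set Fn) : Type
  | var (i : ℕ) : Term F
  | app (g : Fn) (hg : g ∈ F) (args : g.vars → Term F) : Term F

/-- The set of variables that occur in a term. -/
def Term.vars {F : Set Fn} : Term F → Finset ℕ
  | .var i => {i}
  | .app _ _ args => Finset.univ.biUnion fun i => (args i).vars

/-- The value of a term under an assignment of values to the variables. -/
def Term.eval {F : Set Fn} (α : ℕ → Fin 3) : Term F → Fin 3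
  | .var i => α i
  | .app g _ args => g.toFun fun i => (args i).eval α

/-- The term `Φ` realizes the function `f`: they have the same variables and the same values. -/
def Term.Realizes {F : Set Fn} (Φ : Term F) (f : Fn) : Prop :=
  Φ.vars = f.vars ∧ ∀ α : ℕ → Fin 3, Φ.eval α = f.toFun fun i => α i

/-- `[F]`: the functions realized by formulas over `F`. A formula is a term `g(B₁, …, Bₘ)` with
`g ∈ F`; a variable alone is not a formula. -/
def closure (F : Set Fn) : Set Fn :=
  {f | ∃ (g : Fn) (hg : g ∈ F) (args : g.vars → Term F), (Term.app g hg args).Realizes f}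

/-- `A` is a basis of the class `G`: it is a subset of `G` that generates `G`, and no proper
subset of it generates `G`. -/
def IsBasis (A G : Set Fn) : Prop :=
  A ⊆ G ∧ closure A = G ∧ ∀ B : Set Fn, B ⊂ A → closure B ≠ G

end ThreeValued

/-! A finite `F` has only finitely many generating subsets, and a minimal one is a basis. The
substance is that an infinite `F` admits no basis. Up to congruence a member of `F` is determined by
its omitted layer (e, d). Two facts make large functions absorb small ones, relative to a finite
auxiliary set C: the single function `allNonzero` if some member of `F` has e, d ≥ 1, and the empty
set otherwise. Extraction: if f in `F` is generated by A ⊆ [F], then one a in A of at least the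
arity of f generates f together with C. In the first case an innermost zero application of a formula
for f supplies a; conjoining permuted copies of it recovers the whole layer. In the second case
every function in [F] vanishes at 1…1 or 2…2, and an innermost application alone realizes f.
Absorption: identifying variables, and filling places with tautologies, leads from the layer (e',
d') down to (e, d) when e ≤ e' and either d = d' or 1 ≤ d, e + d ≤ d'. Hence all but finitely many f
in `F` are generated, with C, by members of `F` of arbitrarily large arity. A basis A would be
infinite. A finite part of A generates C and the exceptional f; delete any a outside it. Every other
f comes from some g in `F` of larger arity than a, and g from one element of A at least as large,
hence not a. So a was superfluous. -/

namespace ThreeValued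

/-! ### Terms, substitution and the closure operator -/

/-- A formula is a term that is not a single variable. -/
def Term.IsFormula {F : Set Fn} : Term F → Prop
  | .var _ => False
  | .app _ _ _ => True

/-- Simultaneous substitution of terms for variables. -/
def Term.subst {F : Set Fn} (s : ℕ → Term F) : Term F → Term F
  | .var i => s i
  | .app g hg args => .app g hg fun i => (args i).subst s

theorem Term.vars_subst {F : Set Fn} (s : ℕ → Term F) (t : Term F) :
    (t.subst s).vars = t.vars.biUnion fun i => (s i).vars := by
  induction t with
  | var i => simp [Term.subst, Term.vars]
  | app g hg args ih =>
    simp only [Term.subst, Term.vars, ih]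
    rw [Finset.biUnion_biUnion]

theorem Term.eval_subst {F : Set Fn} (s : ℕ → Term F) (α : ℕ → Fin 3) (t : Term F) :
    (t.subst s).eval α = t.eval fun i => (s i).eval α := by
  induction t with
  | var i => simp [Term.subst, Term.eval]
  | app g hg args ih => simp only [Term.subst, Term.eval, ih]

theorem Term.IsFormula.subst {F : Set Fn} (s : ℕ → Term F) {t : Term F} (h : t.IsFormula) :
    (t.subst s).IsFormula := by
  cases t with
  | var i => exact h.elim
  | app g hg args => trivial

theorem Term.eval_congr {F : Set Fn} {α β : ℕ → Fin 3} (t : Term F)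
    (h : ∀ i ∈ t.vars, α i = β i) : t.eval α = t.eval β := by
  induction t with
  | var i => exact h i (by simp [Term.vars])
  | app g hg args ih =>
    simp only [Term.eval]
    congr 1
    funext i
    refine ih i fun j hj => h j ?_
    simp only [Term.vars, Finset.mem_biUnion]
    exact ⟨i, Finset.mem_univ _, hj⟩

theorem Term.vars_arg_subset {F : Set Fn} {g : Fn} (hg : g ∈ F) (args : g.vars → Term F)
    (i : g.vars) : (args i).vars ⊆ (Term.app g hg args).vars :=
  Finset.subset_biUnion_of_mem (fun i => (args i).vars) (Finset.mem_univ i)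

theorem mem_closure_iff {F : Set Fn} {f : Fn} :
    f ∈ closure F ↔ ∃ t : Term F, t.IsFormula ∧ t.Realizes f := by
  constructor
  · rintro ⟨g, hg, args, h⟩
    exact ⟨Term.app g hg args, trivial, h⟩
  · rintro ⟨t, ht, h⟩
    cases t with
    | var i => exact ht.elim
    | app g hg args => exact ⟨g, hg, args, h⟩

theorem subset_closure (F : Set Fn) : F ⊆ closure F := by
  intro f hf
  refine ⟨f, hf, fun i => .var i, ?_, fun α => rfl⟩
  ext x
  simp [Term.vars]

/-- Each symbol of A is expanded into a formula over B, with the translated arguments substituted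
for its variables. -/
theorem exists_term_of_subset_closure {A B : Set Fn} (h : A ⊆ closure B) (t : Term A) :
    ∃ t' : Term B, t'.vars = t.vars ∧ (∀ α, t'.eval α = t.eval α) ∧
      (t.IsFormula → t'.IsFormula) := by
  induction t with
  | var i => exact ⟨.var i, rfl, fun _ => rfl, id⟩
  | app g hg args ih =>
    choose args' hv he _ using ih
    obtain ⟨u, hu, huv, hue⟩ := mem_closure_iff.1 (h hg)
    refine ⟨u.subst fun i => if hi : i ∈ g.vars then args' ⟨i, hi⟩ else .var i, ?_, ?_,
      fun _ => hu.subst _⟩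
    · rw [Term.vars_subst, huv]
      ext x
      simp only [Term.vars, Finset.mem_biUnion, Finset.mem_univ, true_and, Subtype.exists]
      constructor
      · rintro ⟨i, hi, hx⟩
        rw [dif_pos hi, hv] at hx
        exact ⟨i, hi, hx⟩
      · rintro ⟨i, hi, hx⟩
        refine ⟨i, hi, ?_⟩
        rwa [dif_pos hi, hv]
    · intro α
      rw [Term.eval_subst, hue]
      simp only [Term.eval]
      congr 1
      funext i
      simp [he]

theorem closure_subset_closure {A B : Set Fn} (h : A ⊆ closure B) : closure A ⊆ closure B := by
  intro f hf
  obtain ⟨t, ht, hv, he⟩ := mem_closure_iff.1 hf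
  obtain ⟨t', hv', he', ht'⟩ := exists_term_of_subset_closure h t
  exact mem_closure_iff.2 ⟨t', ht' ht, hv'.trans hv, fun α => (he' α).trans (he α)⟩

theorem closure_mono {A B : Set Fn} (h : A ⊆ B) : closure A ⊆ closure B :=
  closure_subset_closure (h.trans (subset_closure B))

/-! ### Finite support of formulas, and bases for finite `F` -/

theorem Term.exists_finite_support {A : Set Fn} (t : Term A) :
    ∃ A' : Set Fn, A' ⊆ A ∧ A'.Finite ∧ ∃ t' : Term A', t'.vars = t.vars ∧
      (∀ α, t'.eval α = t.eval α) ∧ (t.IsFormula → t'.IsFormula) := by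
  induction t with
  | var i => exact ⟨∅, Set.empty_subset _, Set.finite_empty, .var i, rfl, fun _ => rfl, id⟩
  | app g hg args ih =>
    choose S hS hfin u hv he _ using ih
    let T : Set Fn := insert g (⋃ i, S i)
    have hST : ∀ i, S i ⊆ closure T := fun i =>
      ((Set.subset_iUnion S i).trans (Set.subset_insert _ _)).trans (subset_closure _)
    choose w hwv hwe _ using fun i => exists_term_of_subset_closure (hST i) (u i)
    refine ⟨T, Set.insert_subset hg (Set.iUnion_subset hS),
      (Set.finite_iUnion hfin).insert g, .app g (Set.mem_insert _ _) w, ?_, ?_, fun _ => trivial⟩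
    · simp only [Term.vars, hwv, hv]
    · intro α
      simp only [Term.eval, hwe, he]

theorem exists_finite_subset_mem_closure {A : Set Fn} {f : Fn} (hf : f ∈ closure A) :
    ∃ A' ⊆ A, A'.Finite ∧ f ∈ closure A' := by
  obtain ⟨t, ht, hv, he⟩ := mem_closure_iff.1 hf
  obtain ⟨A', hA', hfin, t', hv', he', ht'⟩ := t.exists_finite_support
  exact ⟨A', hA', hfin, mem_closure_iff.2
    ⟨t', ht' ht, hv'.trans hv, fun α => (he' α).trans (he α)⟩⟩

theorem exists_finite_subset_subset_closure {A S : Set Fn} (hS : S.Finite) (h : S ⊆ closure A) :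
    ∃ A' ⊆ A, A'.Finite ∧ S ⊆ closure A' := by
  choose! T hT hfin hmem using fun f (hf : f ∈ S) => exists_finite_subset_mem_closure (h hf)
  refine ⟨⋃ f ∈ S, T f, Set.iUnion₂_subset hT, hS.biUnion hfin, fun f hf => ?_⟩
  exact closure_mono (Set.subset_biUnion_of_mem hf) (hmem f hf)

theorem exists_finite_isBasis_of_finite {F : Set Fn} (hF : F.Finite) :
    ∃ A : Set Fn, A.Finite ∧ IsBasis A (closure F) := by
  have hfin : {S : Set Fn | S ⊆ F ∧ closure S = closure F}.Finite :=
    hF.finite_subsets.subset fun S hS => hS.1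
  obtain ⟨A, hA⟩ := hfin.exists_minimal ⟨F, subset_rfl, rfl⟩
  refine ⟨A, hF.subset hA.prop.1, hA.prop.1.trans (subset_closure F), hA.prop.2, ?_⟩
  intro B hB hBG
  exact hB.2 (hA.le_of_le ⟨hB.1.trans hA.prop.1, hBG⟩ hB.1)

/-! ### Strict functions and counting ones -/

/-- Functions with values in `{0, 1}` that vanish as soon as one argument does. -/
structure Fn.Strict (g : Fn) : Prop where
  eq_zero_or_one : ∀ v, g.toFun v = 0 ∨ g.toFun v = 1
  eq_zero : ∀ v i, v i = 0 → g.toFun v = 0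

theorem Term.eval_eq_zero_or_one {F : Set Fn} (hF : ∀ g ∈ F, g.Strict) {t : Term F}
    (ht : t.IsFormula) (α : ℕ → Fin 3) : t.eval α = 0 ∨ t.eval α = 1 := by
  cases t with
  | var i => exact ht.elim
  | app g hg args => exact (hF g hg).eq_zero_or_one _

theorem Term.eval_eq_zero {F : Set Fn} (hF : ∀ g ∈ F, g.Strict) (t : Term F)
    {α : ℕ → Fin 3} {x : ℕ} (hx : x ∈ t.vars) (h : α x = 0) : t.eval α = 0 := by
  induction t with
  | var i =>
    simp only [Term.vars, Finset.mem_singleton] at hx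
    subst hx
    exact h
  | app g hg args ih =>
    simp only [Term.vars, Finset.mem_biUnion, Finset.mem_univ, true_and] at hx
    obtain ⟨i, hi⟩ := hx
    exact (hF g hg).eq_zero _ i (ih i hi)

theorem exists_extension {V : Finset ℕ} (v : V → Fin 3) :
    ∃ α : ℕ → Fin 3, (fun i : V => α i) = v :=
  ⟨fun i => if hi : i ∈ V then v ⟨i, hi⟩ else 0, by funext i; simp⟩

theorem strict_of_mem_closure {F : Set Fn} (hF : ∀ g ∈ F, g.Strict) {f : Fn}
    (hf : f ∈ closure F) : f.Strict := by
  obtain ⟨t, ht, hv, he⟩ := mem_closure_iff.1 hf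
  constructor
  · intro v
    obtain ⟨α, rfl⟩ := exists_extension v
    rw [← he]
    exact t.eval_eq_zero_or_one hF ht α
  · intro v i hi
    obtain ⟨α, rfl⟩ := exists_extension v
    rw [← he]
    exact t.eval_eq_zero hF (by rw [hv]; exact i.2) hi

/-- The number of components of a tuple that equal `1`. -/
def numOnes {ι : Type*} [Fintype ι] (v : ι → Fin 3) : ℕ :=
  (Finset.univ.filter fun i => v i = 1).card

theorem numOnes_eq_sum {ι : Type*} [Fintype ι] (v : ι → Fin 3) :
    numOnes v = ∑ i, if v i = 1 then 1 else 0 :=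
  Finset.card_filter _ _

theorem numOnes_comp_equiv {ι κ : Type*} [Fintype ι] [Fintype κ] (σ : ι ≃ κ) (v : κ → Fin 3) :
    numOnes (fun i => v (σ i)) = numOnes v := by
  rw [numOnes_eq_sum, numOnes_eq_sum]
  exact σ.sum_comp fun i => if v i = 1 then 1 else 0

theorem numOnes_eq_zero_iff {ι : Type*} [Fintype ι] (v : ι → Fin 3) :
    numOnes v = 0 ↔ ∀ i, v i ≠ 1 := by
  simp [numOnes, Finset.filter_eq_empty_iff]

theorem numOnes_eq_card_iff {ι : Type*} [Fintype ι] (v : ι → Fin 3) :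
    numOnes v = Fintype.card ι ↔ ∀ i, v i = 1 := by
  rw [numOnes, ← Finset.card_univ, Finset.card_filter_eq_iff]
  simp

/-- A bijection between the positions of the ones extends to a permutation; off these positions both
tuples are 2, as zeros are excluded. -/
theorem exists_perm_of_numOnes_eq {ι : Type*} [Fintype ι] {v w : ι → Fin 3}
    (hv : ∀ i, v i ≠ 0) (hw : ∀ i, w i ≠ 0) (h : numOnes v = numOnes w) :
    ∃ σ : Equiv.Perm ι, ∀ i, w (σ i) = v i := by
  classical
  have hcard : Fintype.card {i // v i = 1} = Fintype.card {i // w i = 1} := by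
    simpa [numOnes, Fintype.card_subtype] using h
  let τ := Fintype.equivOfCardEq hcard
  refine ⟨τ.extendSubtype, fun i => ?_⟩
  by_cases hi : v i = 1
  · rw [hi]
    exact τ.extendSubtype_mem i hi
  · have h1 := τ.extendSubtype_not_mem i hi
    have h2 := hw (τ.extendSubtype i)
    have h3 := hv i
    generalize w (τ.extendSubtype i) = a at *
    generalize v i = b at *
    revert h1 h2 h3 hi
    revert a b
    decide

/-! ### Functions omitting one layer -/

/-- The function equals `1` exactly on the tuples without zeros outside the layer of the tuples
with `e` ones and `d` twos, and `0` elsewhere. -/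
structure Fn.OmitsLayer (f : Fn) (e d : ℕ) : Prop where
  add_eq : e + d = f.vars.card
  toFun_eq : ∀ v, f.toFun v = if (∀ i, v i ≠ 0) ∧ numOnes v ≠ e then 1 else 0

theorem mem_cube_iff {V : Finset ℕ} (v : V → Fin 3) : v ∈ cube V ↔ ∀ i, v i ≠ 0 := by
  have h : ∀ a : Fin 3, (a = 1 ∨ a = 2) ↔ a ≠ 0 := by decide
  simp [cube, h]

theorem card_twos {ι : Type*} [Fintype ι] {v : ι → Fin 3} (hv : ∀ i, v i ≠ 0) :
    numOnes v + (Finset.univ.filter fun i => v i = 2).card = Fintype.card ι := by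
  have h : (Finset.univ.filter fun i => v i = 2) = Finset.univ.filter fun i => ¬ v i = 1 := by
    have h3 : ∀ a : Fin 3, a ≠ 0 → (a = 2 ↔ ¬ a = 1) := by decide
    exact Finset.filter_congr fun i _ => h3 _ (hv i)
  rw [h, numOnes, Finset.card_filter_add_card_filter_not, Finset.card_univ]

theorem exists_omitsLayer {f : Fn} (hf : f ∈ SMinusOne) : ∃ e d, f.OmitsLayer e d := by
  obtain ⟨⟨hb, hz⟩, e, d, hed, h⟩ := hf
  refine ⟨e, d, hed, fun v => ?_⟩
  have h1 : f.toFun v = 1 ↔ v ∈ cube f.vars \ layer f.vars e d := by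
    rw [← h]
    rfl
  have h2 : v ∈ cube f.vars \ layer f.vars e d ↔ (∀ i, v i ≠ 0) ∧ numOnes v ≠ e := by
    rw [Set.mem_sdiff, mem_cube_iff]
    refine and_congr_right fun hv => ?_
    have hc := card_twos hv
    rw [Fintype.card_coe] at hc
    simp only [layer, Set.mem_ofPred_eq, mem_cube_iff]
    change ¬ (_ ∧ numOnes v = e ∧ _) ↔ _
    constructor
    · intro hn he
      exact hn ⟨hv, he, by omega⟩
    · rintro hn ⟨-, he, -⟩
      exact hn he
  rw [h2] at h1
  split_ifs with hc
  · exact h1.2 hc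
  · exact (hb v).resolve_right fun h => hc (h1.1 h)

namespace Fn.OmitsLayer

variable {f : Fn} {e d : ℕ}

theorem toFun_eq_zero_iff (hf : f.OmitsLayer e d) (v : f.vars → Fin 3) :
    f.toFun v = 0 ↔ (∃ i, v i = 0) ∨ numOnes v = e := by
  rw [hf.toFun_eq]
  split_ifs with h
  · simp only [one_ne_zero, false_iff, not_or, not_exists]
    exact h
  · rw [not_and_or] at h
    push Not at h
    simpa using h

theorem strict (hf : f.OmitsLayer e d) : f.Strict := by
  constructor
  · intro v
    rw [hf.toFun_eq]
    split_ifs <;> simp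
  · intro v i hi
    exact (hf.toFun_eq_zero_iff v).2 (.inl ⟨i, hi⟩)

theorem congruent {g : Fn} (hf : f.OmitsLayer e d) (hg : g.OmitsLayer e d) : Congruent f g := by
  have hcard : Fintype.card f.vars = Fintype.card g.vars := by
    rw [Fintype.card_coe, Fintype.card_coe, ← hf.add_eq, hg.add_eq]
  let σ := Fintype.equivOfCardEq hcard
  refine ⟨σ, fun α => ?_⟩
  rw [hf.toFun_eq, hg.toFun_eq, numOnes_comp_equiv σ α]
  have : (∀ i, α i ≠ 0) ↔ ∀ i, α (σ i) ≠ 0 :=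
    (σ.forall_congr_right (q := fun i => α i ≠ 0)).symm
  simp only [this]

end Fn.OmitsLayer

/-- Swapping 1 and 2 at x leaves the layer. Thus an application whose zeros stay inside one layer
must involve every variable, which gives the arity bounds below. -/
theorem exists_numOnes_ne {V : Finset ℕ} {x : ℕ} (hx : x ∈ V) {α : ℕ → Fin 3}
    (hα : ∀ i ∈ V, α i ≠ 0) : ∃ β : ℕ → Fin 3, (∀ i, i ≠ x → β i = α i) ∧
      (∀ i ∈ V, β i ≠ 0) ∧ numOnes (fun i : V => β i) ≠ numOnes fun i : V => α i := by
  have hne : ∀ i, i ≠ x → Function.update α x (if α x = 1 then 2 else 1) i = α i :=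
    fun i hi => Function.update_of_ne hi _ _
  refine ⟨Function.update α x (if α x = 1 then 2 else 1), hne, fun i hi => ?_, ?_⟩
  · rcases eq_or_ne i x with rfl | h
    · rw [Function.update_self]
      split_ifs <;> decide
    · rw [hne i h]
      exact hα i hi
  · rw [numOnes_eq_sum, numOnes_eq_sum, ← Finset.add_sum_erase _ _ (Finset.mem_univ ⟨x, hx⟩),
      ← Finset.add_sum_erase (a := ⟨x, hx⟩) _ (fun i : V => if α i = 1 then 1 else 0)
        (Finset.mem_univ _)]
    have hs : (∑ i ∈ Finset.univ.erase (⟨x, hx⟩ : V),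
        if Function.update α x (if α x = 1 then 2 else 1) (i : ℕ) = 1 then 1 else 0) =
        ∑ i ∈ Finset.univ.erase (⟨x, hx⟩ : V), if α (i : ℕ) = 1 then 1 else 0 := by
      refine Finset.sum_congr rfl fun i hi => ?_
      rw [hne]
      exact fun h => (Finset.mem_erase.1 hi).1 (Subtype.ext h)
    rw [hs]
    by_cases h : α x = 1 <;> simp [h]

/-! ### Conjunction, tautologies and symmetrization -/

/-- The binary function that equals `1` on `{1, 2}²` and `0` elsewhere. -/
def allNonzero : Fn where
  vars := {0, 1}
  vars_nonempty := by simp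
  toFun v := if ∀ i, v i ≠ 0 then 1 else 0

theorem strict_allNonzero : allNonzero.Strict := by
  constructor
  · intro v
    simp only [allNonzero]
    split_ifs <;> simp
  · intro v i hi
    exact if_neg fun h => h i hi

/-- The application of `allNonzero` to two terms. -/
def Term.conj {F : Set Fn} (hF : allNonzero ∈ F) (s t : Term F) : Term F :=
  .app allNonzero hF fun i => if (i : ℕ) = 0 then s else t

theorem Term.vars_conj {F : Set Fn} (hF : allNonzero ∈ F) (s t : Term F) :
    (Term.conj hF s t).vars = s.vars ∪ t.vars := by
  ext x
  simp only [Term.conj, Term.vars, Finset.mem_biUnion, Finset.mem_univ, true_and, Subtype.exists,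
    Finset.mem_union]
  constructor
  · rintro ⟨i, hi, hx⟩
    split_ifs at hx
    exacts [.inl hx, .inr hx]
  · rintro (h | h)
    · exact ⟨0, by simp [allNonzero], by simpa using h⟩
    · exact ⟨1, by simp [allNonzero], by simpa using h⟩

theorem Term.eval_conj {F : Set Fn} (hF : allNonzero ∈ F) (s t : Term F) (α : ℕ → Fin 3) :
    (Term.conj hF s t).eval α = if s.eval α ≠ 0 ∧ t.eval α ≠ 0 then 1 else 0 := by
  simp only [Term.conj, Term.eval, allNonzero]
  refine if_congr ?_ rfl rfl
  constructor
  · intro h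
    exact ⟨by simpa using h ⟨0, by simp⟩, by simpa using h ⟨1, by simp⟩⟩
  · rintro ⟨h1, h2⟩ i
    split_ifs
    exacts [h1, h2]

theorem exists_conj {F : Set Fn} (hF : allNonzero ∈ F) {ι : Type*} (s : Finset ι)
    (hs : s.Nonempty) (t : ι → Term F) : ∃ u : Term F, u.IsFormula ∧
      (∀ x, x ∈ u.vars ↔ ∃ i ∈ s, x ∈ (t i).vars) ∧
      ∀ α, u.eval α = if ∀ i ∈ s, (t i).eval α ≠ 0 then 1 else 0 := by
  induction hs using Finset.Nonempty.cons_induction with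
  | singleton a =>
    -- Conjoining the term with itself makes it a formula and turns the value 2 into 1.
    refine ⟨.conj hF (t a) (t a), trivial, fun x => by simp [Term.vars_conj], fun α => ?_⟩
    rw [Term.eval_conj]
    simp
  | cons a s ha hs ih =>
    obtain ⟨u, -, hv, he⟩ := ih
    refine ⟨.conj hF (t a) u, trivial, fun x => by simp [Term.vars_conj, hv], fun α => ?_⟩
    rw [Term.eval_conj, he]
    refine if_congr ?_ rfl rfl
    simp

theorem exists_tautology {F : Set Fn} (hF : allNonzero ∈ F) {V : Finset ℕ} (hV : V.Nonempty) :
    ∃ u : Term F, u.IsFormula ∧ u.vars = V ∧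
      ∀ α, u.eval α = if ∀ i ∈ V, α i ≠ 0 then 1 else 0 := by
  obtain ⟨u, hu, hv, he⟩ := exists_conj hF V hV fun i => .var i
  refine ⟨u, hu, ?_, he⟩
  ext x
  simp [hv, Term.vars]

/-- If a formula over `F` vanishes somewhere on `{1, 2}^V`, but only inside one layer, then the
conjunction of all its versions with permuted variables omits exactly this layer. -/
theorem mem_closure_of_zeros_subset_layer {F : Set Fn} (hF : allNonzero ∈ F) {f : Fn} {e d : ℕ}
    (hf : f.OmitsLayer e d) (t : Term F) (hv : t.vars ⊆ f.vars) {α : ℕ → Fin 3}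
    (hα : ∀ i ∈ f.vars, α i ≠ 0) (hα0 : t.eval α = 0)
    (ht : ∀ β : ℕ → Fin 3, (∀ i ∈ f.vars, β i ≠ 0) → t.eval β = 0 →
      numOnes (fun i : f.vars => β i) = e) :
    f ∈ closure F := by
  classical
  obtain ⟨u, -, huv, hue⟩ := exists_tautology hF f.vars_nonempty
  let r (σ : Equiv.Perm f.vars) (i : ℕ) : ℕ := if hi : i ∈ f.vars then σ ⟨i, hi⟩ else i
  have hr : ∀ σ (i : f.vars), r σ i = σ i := fun σ i => by simp [r]
  have hrmem : ∀ σ, ∀ i ∈ f.vars, r σ i ∈ f.vars := fun σ i hi => by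
    simp only [r, dif_pos hi]
    exact (σ ⟨i, hi⟩).2
  -- The index `none` adds the tautology, so that all variables of `f` occur even if `t` misses
  -- some.
  obtain ⟨w, hw, hwv, hwe⟩ := exists_conj hF (Finset.univ : Finset (Option (Equiv.Perm f.vars)))
    ⟨none, Finset.mem_univ _⟩ fun o => o.elim u fun σ => t.subst fun i => .var (r σ i)
  refine mem_closure_iff.2 ⟨w, hw, ?_, fun β => ?_⟩
  · ext x
    rw [hwv]
    constructor
    · rintro ⟨o, -, hx⟩
      cases o with
      | none => simpa [huv] using hx
      | some σ =>
        simp only [Option.elim_some, Term.vars_subst, Term.vars, Finset.mem_biUnion,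
          Finset.mem_singleton] at hx
        obtain ⟨i, hi, rfl⟩ := hx
        exact hrmem σ i (hv hi)
    · intro hx
      exact ⟨none, Finset.mem_univ _, by simpa [huv] using hx⟩
  · rw [hwe, hf.toFun_eq]
    congr 1
    refine propext ?_
    simp only [Finset.mem_univ, true_imp_iff, Option.forall, Option.elim_none, Option.elim_some,
      Term.eval_subst, Term.eval, hue]
    have h1 : ((if ∀ i ∈ f.vars, β i ≠ 0 then 1 else 0 : Fin 3) ≠ 0) ↔
        ∀ i : f.vars, β i ≠ 0 := by
      split_ifs with h <;> simpa using h
    rw [h1]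
    refine and_congr_right fun hβ => ?_
    constructor
    · intro h hne
      have hcount := ht α hα hα0
      obtain ⟨σ, hσ⟩ := exists_perm_of_numOnes_eq (v := fun i : f.vars => α i)
        (w := fun i : f.vars => β i) (fun i => hα i i.2) hβ (hcount.trans hne.symm)
      refine h σ ?_
      rw [← hα0]
      refine t.eval_congr fun i hi => ?_
      have := hσ ⟨i, hv hi⟩
      rw [← this]
      exact congrArg β (hr σ ⟨i, hv hi⟩)
    · intro h σ h0
      refine h ?_
      rw [← ht (fun i => β (r σ i)) (fun i hi => hβ ⟨_, hrmem σ i hi⟩) h0]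
      simp only [hr]
      exact (numOnes_comp_equiv σ fun i : f.vars => β i).symm

theorem realizes_of_eval_eq_zero_iff {F : Set Fn} (hF : ∀ g ∈ F, g.Strict) {f : Fn}
    (hf : f.Strict) {t : Term F} (ht : t.IsFormula) (hv : t.vars = f.vars)
    (h : ∀ α : ℕ → Fin 3, (∀ i ∈ f.vars, α i ≠ 0) →
      (t.eval α = 0 ↔ f.toFun (fun i => α i) = 0)) : t.Realizes f := by
  refine ⟨hv, fun α => ?_⟩
  by_cases hα : ∀ i ∈ f.vars, α i ≠ 0
  · have h0 := h α hα
    rcases t.eval_eq_zero_or_one hF ht α with h1 | h1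
    · rw [h1, h0.1 h1]
    · rcases hf.eq_zero_or_one fun i => α i with h2 | h2
      · rw [h0.2 h2, h2]
      · rw [h1, h2]
  · push Not at hα
    obtain ⟨i, hi, hi0⟩ := hα
    rw [t.eval_eq_zero hF (hv ▸ hi) hi0, hf.eq_zero _ ⟨i, hi⟩ hi0]

/-! ### Passing from a larger layer to a smaller one -/

/-- Identify variables of `g` so that `j` occurs `m + 1` times and every other variable of `V`
once, and fill the remaining `r` places with a tautology. -/
theorem exists_weighted_term {F : Set Fn} {g : Fn} (hgF : g ∈ F) {e d : ℕ}
    (hg : g.OmitsLayer e d) {V : Finset ℕ} {j : ℕ} (hj : j ∈ V) {m r : ℕ}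
    (hcard : g.vars.card = V.card + m + r) (u : Term F)
    (hu : r ≠ 0 → u.vars = V ∧ ∀ α, u.eval α = if ∀ i ∈ V, α i ≠ 0 then 1 else 0) :
    ∃ t : Term F, t.IsFormula ∧ t.vars = V ∧ ∀ α : ℕ → Fin 3, (∀ i ∈ V, α i ≠ 0) →
      (t.eval α = 0 ↔
        numOnes (fun i : V => α i) + (if α j = 1 then m else 0) + r = e) := by
  have hc : Fintype.card g.vars = Fintype.card ((V ⊕ Fin m) ⊕ Fin r) := by
    simp [hcard]
  let σ := Fintype.equivOfCardEq hc
  let a : (V ⊕ Fin m) ⊕ Fin r → Term F :=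
    Sum.elim (Sum.elim (fun x => .var x) fun _ => .var j) fun _ => u
  refine ⟨.app g hgF fun i => a (σ i), trivial, ?_, fun α hα => ?_⟩
  · ext x
    simp only [Term.vars, Finset.mem_biUnion, Finset.mem_univ, true_and]
    constructor
    · rintro ⟨i, hi⟩
      generalize σ i = z at hi
      rcases z with (y | y) | y
      · simp only [a, Sum.elim_inl, Term.vars, Finset.mem_singleton] at hi
        exact hi ▸ y.2
      · simp only [a, Sum.elim_inl, Sum.elim_inr, Term.vars, Finset.mem_singleton] at hi
        exact hi ▸ hj
      · rw [← (hu fun h => (h ▸ y).elim0).1]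
        exact hi
    · intro hx
      exact ⟨σ.symm (.inl (.inl ⟨x, hx⟩)), by simp [a, Term.vars]⟩
  · have hu1 : ∀ _ : Fin r, u.eval α = 1 := fun y => by
      rw [(hu fun h => (h ▸ y).elim0).2, if_pos hα]
    have ha : ∀ y, (a y).eval α ≠ 0 := by
      rintro ((y | y) | y)
      · exact hα y y.2
      · exact hα j hj
      · simp [a, hu1 y]
    simp only [Term.eval]
    rw [hg.toFun_eq_zero_iff, or_iff_right fun ⟨i, hi⟩ => ha _ hi,
      numOnes_comp_equiv σ fun y => (a y).eval α, numOnes_eq_sum, Fintype.sum_sum_type,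
      Fintype.sum_sum_type, numOnes_eq_sum]
    have h2 : (∑ y : Fin r, if (a (.inr y)).eval α = 1 then 1 else 0) = r := by
      have : ∀ y : Fin r, (if (a (.inr y)).eval α = 1 then 1 else 0) = 1 := fun y => by
        simp [a, hu1 y]
      simp [this]
    rw [h2]
    simp only [a, Sum.elim_inl, Sum.elim_inr, Term.eval]
    simp

theorem exists_numOnes_eq {V : Finset ℕ} {j : ℕ} (hj : j ∈ V) {e d : ℕ} (h : e + d = V.card) :
    ∃ α : ℕ → Fin 3, (∀ i ∈ V, α i ≠ 0) ∧ numOnes (fun i : V => α i) = e ∧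
      (1 ≤ d → α j ≠ 1) := by
  obtain ⟨S, hSV, hS, hjS⟩ : ∃ S ⊆ V, S.card = e ∧ (1 ≤ d → j ∉ S) := by
    rcases Nat.eq_zero_or_pos d with rfl | hd
    · exact ⟨V, subset_rfl, by omega, by omega⟩
    · obtain ⟨S, hS, hSe⟩ := Finset.exists_subset_card_eq
        (show e ≤ (V.erase j).card by rw [Finset.card_erase_of_mem hj]; omega)
      exact ⟨S, hS.trans (Finset.erase_subset _ _), hSe,
        fun _ hjS => (Finset.mem_erase.1 (hS hjS)).1 rfl⟩
  refine ⟨fun i => if i ∈ S then 1 else 2, fun i _ => ?_, ?_, fun hd => ?_⟩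
  · dsimp only
    split_ifs <;> decide
  · rw [numOnes_eq_sum, Finset.sum_coe_sort V fun i => if (if i ∈ S then (1 : Fin 3) else 2) = 1
      then 1 else 0, ← hS, Finset.card_eq_sum_ones, ← Finset.sum_filter]
    refine Finset.sum_congr ?_ fun _ _ => rfl
    ext i
    by_cases hi : i ∈ S
    · simp [hi, hSV hi]
    · simp [hi]
  · simp [hjS hd]

/-- When the function omitting a layer `(e, d)` is obtained from the one omitting `(e', d')`. -/
theorem mem_closure_of_omitsLayer {F : Set Fn} (hF : ∀ g ∈ F, g.Strict) {f g : Fn}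
    {e d e' d' : ℕ} (hf : f.OmitsLayer e d) (hg : g.OmitsLayer e' d') (hgF : g ∈ F)
    (he : e ≤ e') (hd : d = d' ∨ 1 ≤ d ∧ e + d ≤ d')
    (h : allNonzero ∈ F ∨ e = 0 ∧ e' = 0 ∨ d = 0 ∧ d' = 0) : f ∈ closure F := by
  obtain ⟨j, hj⟩ := f.vars_nonempty
  have hfc := hf.add_eq
  have hgc := hg.add_eq
  have hj1 : ∀ α : ℕ → Fin 3, numOnes (fun i : f.vars => α i) = 0 → α j ≠ 1 := fun α h0 =>
    (numOnes_eq_zero_iff _).1 h0 ⟨j, hj⟩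
  rcases h with h | ⟨rfl, rfl⟩ | ⟨rfl, rfl⟩
  · obtain ⟨u, -, huv, hue⟩ := exists_tautology h f.vars_nonempty
    obtain ⟨t, -, htv, hte⟩ := exists_weighted_term hgF hg hj
      (show g.vars.card = f.vars.card + (d' - d) + (e' - e) by omega) u fun _ => ⟨huv, hue⟩
    obtain ⟨α, hα, hαe, hαj⟩ := exists_numOnes_eq hj hfc
    refine mem_closure_of_zeros_subset_layer h hf t htv.subset hα ?_ fun β hβ hβ0 => ?_
    · rw [hte α hα, hαe]
      split_ifs with h1
      · have : ¬ 1 ≤ d := fun hd => hαj hd h1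
        omega
      · omega
    -- A zero with `β j = 1` would give `numOnes + (d' - d) = e` with `numOnes ≥ 1`; this is
    -- impossible if `d' - d ≥ e`, and harmless if `d = d'`.
    · rw [hte β hβ] at hβ0
      have := hj1 β
      split_ifs at hβ0 <;> grind
  -- For constant layers no place is filled (`r = 0`), so `.var 0` is a dummy and no tautology is
  -- needed.
  · obtain ⟨t, ht, htv, hte⟩ := exists_weighted_term hgF hg hj
      (show g.vars.card = f.vars.card + (d' - d) + 0 by omega) (.var 0) fun h => (h rfl).elim
    refine mem_closure_iff.2 ⟨t, ht, realizes_of_eval_eq_zero_iff hF hf.strict ht htv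
      fun α hα => ?_⟩
    rw [hte α hα, hf.toFun_eq_zero_iff, or_iff_right fun ⟨i, hi⟩ => hα i i.2 hi]
    have := hj1 α
    split_ifs <;> grind
  · obtain ⟨t, ht, htv, hte⟩ := exists_weighted_term hgF hg hj
      (show g.vars.card = f.vars.card + (e' - e) + 0 by omega) (.var 0) fun h => (h rfl).elim
    refine mem_closure_iff.2 ⟨t, ht, realizes_of_eval_eq_zero_iff hF hf.strict ht htv
      fun α hα => ?_⟩
    rw [hte α hα, hf.toFun_eq_zero_iff, or_iff_right fun ⟨i, hi⟩ => hα i i.2 hi]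
    have hle : numOnes (fun i : f.vars => α i) ≤ e := by
      have := Finset.card_filter_le Finset.univ fun i : f.vars => α i = 1
      rw [Finset.card_univ, Fintype.card_coe] at this
      exact this.trans (by omega)
    have hj2 : numOnes (fun i : f.vars => α i) = e → α j = 1 := fun h0 =>
      (numOnes_eq_card_iff fun i : f.vars => α i).1
        (by rw [h0, Fintype.card_coe]; omega) ⟨j, hj⟩
    split_ifs with h1
    · omega
    · have : numOnes (fun i : f.vars => α i) ≠ e := fun h => h1 (hj2 h)
      omega

/-- Neither constant tuple lies in the layer, so f(x, …, x) is 1 for every nonzero x. Nesting gives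
f(f(x₀, …), f(x₁, …), …) = f(1, …, 1) = 1 on nonzero arguments. -/
theorem allNonzero_mem_closure {F : Set Fn} (hF : ∀ g ∈ F, g.Strict) {f : Fn} (hfF : f ∈ F)
    {e d : ℕ} (hf : f.OmitsLayer e d) (he : 1 ≤ e) (hd : 1 ≤ d) : allNonzero ∈ closure F := by
  let T (x : ℕ) : Term F := .app f hfF fun _ => .var x
  have hTv : ∀ x, (T x).vars = {x} := fun x => by
    obtain ⟨j, hj⟩ := f.vars_nonempty
    ext y
    simp only [T, Term.vars, Finset.mem_biUnion, Finset.mem_univ, true_and]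
    exact ⟨fun ⟨_, h⟩ => h, fun h => ⟨⟨j, hj⟩, h⟩⟩
  have hfc := hf.add_eq
  have hone : numOnes (fun _ : f.vars => (1 : Fin 3)) = e + d := by
    rw [hfc, ← Fintype.card_coe, numOnes_eq_card_iff]
    exact fun _ => rfl
  have hT : ∀ x α, α x ≠ 0 → (T x).eval α = 1 := fun x α hx => by
    refine ((T x).eval_eq_zero_or_one hF trivial α).resolve_left fun h0 => ?_
    simp only [T, Term.eval] at h0
    rw [hf.toFun_eq_zero_iff, or_iff_right fun ⟨_, hi⟩ => hx hi] at h0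
    by_cases h1 : α x = 1
    · rw [h1, hone] at h0
      omega
    · rw [(numOnes_eq_zero_iff _).2 fun _ => h1] at h0
      omega
  obtain ⟨i, hi, k, hk, hik⟩ := Finset.one_lt_card.1 (show 1 < f.vars.card by omega)
  let t : Term F := .app f hfF fun x => T (if (x : ℕ) = i then 0 else 1)
  have htv : t.vars = {0, 1} := by
    ext x
    simp only [t, Term.vars, hTv, Finset.mem_biUnion, Finset.mem_univ, true_and, Subtype.exists,
      Finset.mem_singleton, Finset.mem_insert]
    constructor
    · rintro ⟨y, -, rfl⟩
      split_ifs <;> simp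
    · rintro (h | h)
      · exact ⟨i, hi, by simpa using h⟩
      · exact ⟨k, hk, by simpa [hik.symm] using h⟩
  refine mem_closure_iff.2 ⟨t, trivial, realizes_of_eval_eq_zero_iff hF strict_allNonzero trivial
    htv fun α hα => ?_⟩
  have h1 : ∀ x : f.vars, (T (if (x : ℕ) = i then 0 else 1)).eval α = 1 := fun x => by
    refine hT _ _ (hα _ ?_)
    simp only [allNonzero]
    split_ifs <;> simp
  have h2 : t.eval α ≠ 0 := by
    simp only [t, Term.eval, h1]
    rw [Ne, hf.toFun_eq_zero_iff, or_iff_right (by simp), hone]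
    omega
  have h3 : allNonzero.toFun (fun i : allNonzero.vars => α i) = 1 :=
    if_pos fun i : allNonzero.vars => hα i i.2
  simp [h2, h3]

/-! ### Extracting a single generator from a formula -/

/-- A zero of a formula comes from an innermost application: replacing the arguments that are
formulas by `1` leaves a zero there, and creates no new zeros. -/
theorem Term.exists_zero_application {A : Set Fn} (hA : ∀ g ∈ A, g.Strict) {t : Term A}
    (ht : t.IsFormula) {α : ℕ → Fin 3} (h0 : t.eval α = 0) :
    ∃ a ∈ A, ∃ s : a.vars → Option ℕ, (∀ i, ∀ x ∈ s i, x ∈ t.vars) ∧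
      a.toFun (fun i => (s i).elim 1 α) = 0 ∧
      ∀ β : ℕ → Fin 3, a.toFun (fun i => (s i).elim 1 β) = 0 → t.eval β = 0 := by
  induction t with
  | var i => exact ht.elim
  | app g hg args ih =>
    by_cases hex : ∃ i, (args i).IsFormula ∧ (args i).eval α = 0
    · obtain ⟨i, hi, hi0⟩ := hex
      obtain ⟨a, ha, s, hs, hsα, hsβ⟩ := ih i hi hi0
      exact ⟨a, ha, s, fun k x hx => vars_arg_subset hg args i (hs k x hx), hsα,
        fun β hβ => (hA g hg).eq_zero _ i (hsβ β hβ)⟩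
    -- No formula argument vanishes at `α`, so each has value 1 there; `none` marks these places.
    · let s (i : g.vars) : Option ℕ := match args i with
        | .var x => some x
        | .app _ _ _ => none
      have hs : ∀ i (β : ℕ → Fin 3), ((args i).IsFormula → (args i).eval β ≠ 0) →
          (s i).elim 1 β = (args i).eval β := by
        intro i β hβ
        simp only [s]
        generalize args i = u at *
        cases u with
        | var x => rfl
        | app g' hg' args' =>
          exact (((Term.app g' hg' args').eval_eq_zero_or_one hA trivial β).resolve_left
            (hβ trivial)).symm
      refine ⟨g, hg, s, fun i x hx => vars_arg_subset hg args i ?_, ?_, fun β hβ => ?_⟩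
      · simp only [s] at hx
        generalize args i = u at *
        cases u with
        | var y =>
          obtain rfl : y = x := by simpa using hx
          simp [Term.vars]
        | app g' hg' args' => simp at hx
      · rw [← h0]
        simp only [Term.eval]
        congr 1
        funext i
        exact hs i α fun hi hi0 => hex ⟨i, hi, hi0⟩
      · by_cases hexβ : ∃ i, (args i).IsFormula ∧ (args i).eval β = 0
        · obtain ⟨i, -, hi0⟩ := hexβ
          exact (hA g hg).eq_zero _ i hi0
        · rw [← hβ]
          simp only [Term.eval]
          congr 1
          funext i
          exact (hs i β fun hi hi0 => hexβ ⟨i, hi, hi0⟩).symm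

/-- An innermost application in a formula: all of its arguments are variables. -/
theorem Term.exists_innermost_application {A : Set Fn} (hA : ∀ g ∈ A, g.Strict) {t : Term A}
    (ht : t.IsFormula) : ∃ a ∈ A, ∃ s : a.vars → ℕ, (∀ i, s i ∈ t.vars) ∧
      ∀ β : ℕ → Fin 3, a.toFun (fun i => β (s i)) = 0 → t.eval β = 0 := by
  induction t with
  | var i => exact ht.elim
  | app g hg args ih =>
    by_cases hex : ∃ i, (args i).IsFormula
    · obtain ⟨i, hi⟩ := hex
      obtain ⟨a, ha, s, hs, hsβ⟩ := ih i hi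
      exact ⟨a, ha, s, fun k => vars_arg_subset hg args i (hs k),
        fun β hβ => (hA g hg).eq_zero _ i (hsβ β hβ)⟩
    · have hvar : ∀ i, ∃ x, args i = .var x := by
        intro i
        have hi : ¬ (args i).IsFormula := fun h => hex ⟨i, h⟩
        generalize args i = u at *
        cases u with
        | var x => exact ⟨x, rfl⟩
        | app g' hg' args' => exact (hi trivial).elim
      choose s hs using hvar
      refine ⟨g, hg, s, fun i => vars_arg_subset hg args i (by simp [hs, Term.vars]),
        fun β hβ => ?_⟩
      simpa only [Term.eval, hs] using hβ

/-- A function omitting a layer that is generated by `A` is generated by a single element of `A`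
together with `allNonzero`. -/
theorem exists_mem_closure_pair {A : Set Fn} (hA : ∀ g ∈ A, g.Strict) {f : Fn} {e d : ℕ}
    (hf : f.OmitsLayer e d) (hfA : f ∈ closure A) :
    ∃ a ∈ A, f.vars.card ≤ a.vars.card ∧ f ∈ closure {a, allNonzero} := by
  obtain ⟨t, ht, htv, hte⟩ := mem_closure_iff.1 hfA
  obtain ⟨j, hj⟩ := f.vars_nonempty
  obtain ⟨α, hα, hαe, -⟩ := exists_numOnes_eq hj hf.add_eq
  obtain ⟨a, ha, s, hs, hsα, hsβ⟩ := t.exists_zero_application hA ht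
    (show t.eval α = 0 by rw [hte, hf.toFun_eq_zero_iff]; exact .inr hαe)
  have hzero : ∀ β : ℕ → Fin 3, (∀ i ∈ f.vars, β i ≠ 0) →
      a.toFun (fun i => (s i).elim 1 β) = 0 → numOnes (fun i : f.vars => β i) = e := by
    intro β hβ hβ0
    have := hsβ β hβ0
    rwa [hte, hf.toFun_eq_zero_iff, or_iff_right fun ⟨i, hi⟩ => hβ i i.2 hi] at this
  refine ⟨a, ha, ?_, ?_⟩
  -- A variable absent from `s` could be flipped without destroying the zero, yet the flip leaves
  -- the layer.
  · have hsub : f.vars.image some ⊆ Finset.univ.image s := by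
      intro o ho
      obtain ⟨x, hx, rfl⟩ := Finset.mem_image.1 ho
      by_contra hxs
      obtain ⟨β, hβα, hβ, hne⟩ := exists_numOnes_ne hx hα
      refine hne (Eq.trans (hzero β hβ ?_) hαe.symm)
      rw [← hsα]
      congr 1
      funext i
      cases hi : s i with
      | none => rfl
      | some y =>
        refine hβα y ?_
        rintro rfl
        exact hxs (Finset.mem_image.2 ⟨i, Finset.mem_univ _, hi⟩)
    have := Finset.card_le_card hsub
    rw [Finset.card_image_of_injective _ (Option.some_injective _)] at this
    refine this.trans (Finset.card_image_le.trans ?_)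
    simp
  · have hmem : allNonzero ∈ ({a, allNonzero} : Set Fn) := Set.mem_insert_of_mem _ rfl
    have hmem' : a ∈ ({a, allNonzero} : Set Fn) := Set.mem_insert _ _
    obtain ⟨u, -, huv, hue⟩ := exists_tautology hmem f.vars_nonempty
    have heval : ∀ β : ℕ → Fin 3, (∀ i ∈ f.vars, β i ≠ 0) →
        (Term.app a hmem' fun i => (s i).elim u .var).eval β =
          a.toFun fun i => (s i).elim 1 β := by
      intro β hβ
      simp only [Term.eval]
      congr 1
      funext i
      cases s i with
      | none => simp only [Option.elim_none, hue, if_pos hβ]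
      | some y => rfl
    refine mem_closure_of_zeros_subset_layer hmem hf
      (.app a hmem' fun i => (s i).elim u .var) ?_ hα ((heval α hα).trans hsα)
      fun β hβ hβ0 => hzero β hβ ((heval β hβ).symm.trans hβ0)
    intro x hx
    simp only [Term.vars, Finset.mem_biUnion, Finset.mem_univ, true_and] at hx
    obtain ⟨i, hi⟩ := hx
    cases hsi : s i with
    | none => simpa [hsi, huv] using hi
    | some y =>
      have hxy : x = y := by simpa [hsi, Term.vars] using hi
      rw [hxy, ← htv]
      exact hs i y hsi

/-- If every element of `A` vanishes at a constant tuple `1…1` or `2…2`, then a function omitting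
such a tuple only that is generated by `A` is generated by a single element of `A`. -/
theorem exists_mem_closure_singleton {A : Set Fn} (hA : ∀ g ∈ A, g.Strict)
    (hA0 : ∀ g ∈ A, ∃ c : Fin 3, c ≠ 0 ∧ g.toFun (fun _ => c) = 0) {f : Fn} {e d : ℕ}
    (hf : f.OmitsLayer e d) (hed : e = 0 ∨ d = 0) (hfA : f ∈ closure A) :
    ∃ a ∈ A, f.vars.card ≤ a.vars.card ∧ f ∈ closure {a} := by
  obtain ⟨t, ht, htv, hte⟩ := mem_closure_iff.1 hfA
  obtain ⟨a, ha, s, hs, hsβ⟩ := t.exists_innermost_application hA ht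
  obtain ⟨c, hc, hac⟩ := hA0 a ha
  have hzero : ∀ β : ℕ → Fin 3, (∀ i ∈ f.vars, β i ≠ 0) →
      a.toFun (fun i => β (s i)) = 0 → numOnes (fun i : f.vars => β i) = e := by
    intro β hβ hβ0
    have := hsβ β hβ0
    rwa [hte, hf.toFun_eq_zero_iff, or_iff_right fun ⟨i, hi⟩ => hβ i i.2 hi] at this
  have hce : numOnes (fun _ : f.vars => c) = e := hzero (fun _ => c) (fun _ _ => hc) hac
  -- The omitted layer is a single constant tuple, necessarily the one at which `a` vanishes.
  have hconst : ∀ β : ℕ → Fin 3, (∀ i ∈ f.vars, β i ≠ 0) →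
      numOnes (fun i : f.vars => β i) = e → ∀ i ∈ f.vars, β i = c := by
    intro β hβ hβe i hi
    have h12 : ∀ x y : Fin 3, x ≠ 0 → y ≠ 0 → x ≠ 1 → y ≠ 1 → x = y := by decide
    have hfc := hf.add_eq
    rcases hed with rfl | rfl
    · exact h12 _ _ (hβ i hi) hc ((numOnes_eq_zero_iff _).1 hβe ⟨i, hi⟩)
        ((numOnes_eq_zero_iff _).1 hce ⟨i, hi⟩)
    · have he : e = Fintype.card f.vars := by rw [Fintype.card_coe]; omega
      rw [he] at hβe hce
      exact ((numOnes_eq_card_iff _).1 hβe ⟨i, hi⟩).trans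
        ((numOnes_eq_card_iff _).1 hce ⟨i, hi⟩).symm
  have hrange : Finset.univ.image s = f.vars := by
    refine Finset.Subset.antisymm ?_ fun x hx => ?_
    · intro x hx
      obtain ⟨i, -, rfl⟩ := Finset.mem_image.1 hx
      exact htv ▸ hs i
    · by_contra hxs
      obtain ⟨β, hβα, hβ, hne⟩ := exists_numOnes_ne hx (α := fun _ => c) fun _ _ => hc
      refine hne (Eq.trans (hzero β hβ ?_) hce.symm)
      rw [← hac]
      congr 1
      funext i
      refine hβα (s i) ?_
      intro h
      exact hxs (Finset.mem_image.2 ⟨i, Finset.mem_univ _, h⟩)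
  refine ⟨a, ha, ?_, ?_⟩
  · rw [← hrange]
    exact Finset.card_image_le.trans (by simp)
  · refine mem_closure_iff.2 ⟨.app a (Set.mem_singleton a) fun i => .var (s i), trivial,
      realizes_of_eval_eq_zero_iff (by rintro g rfl; exact hA g ha) hf.strict trivial ?_
      fun β hβ => ?_⟩
    · rw [← hrange]
      ext x
      simp [Term.vars, eq_comm]
    · rw [hf.toFun_eq_zero_iff, or_iff_right fun ⟨i, hi⟩ => hβ i i.2 hi]
      refine ⟨hzero β hβ, fun hβe => ?_⟩
      rw [← hac]
      simp only [Term.eval]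
      congr 1
      funext i
      exact hconst β hβ hβe _ (htv ▸ hs i)

/-- An innermost application has only variables as arguments, so a constant assignment reaches it as
a constant tuple; strictness carries the zero outwards. -/
theorem exists_const_zero_of_mem_closure {F : Set Fn} (hF : ∀ g ∈ F, g.Strict)
    (hF0 : ∀ g ∈ F, ∃ c : Fin 3, c ≠ 0 ∧ g.toFun (fun _ => c) = 0) {f : Fn}
    (hf : f ∈ closure F) : ∃ c : Fin 3, c ≠ 0 ∧ f.toFun (fun _ => c) = 0 := by
  obtain ⟨t, ht, htv, hte⟩ := mem_closure_iff.1 hf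
  obtain ⟨a, ha, s, -, hsβ⟩ := t.exists_innermost_application hF ht
  obtain ⟨c, hc, hac⟩ := hF0 a ha
  exact ⟨c, hc, (hte fun _ => c).symm.trans (hsβ (fun _ => c) hac)⟩

theorem exists_const_zero_of_omitsLayer {f : Fn} {e d : ℕ} (hf : f.OmitsLayer e d)
    (hed : e = 0 ∨ d = 0) : ∃ c : Fin 3, c ≠ 0 ∧ f.toFun (fun _ => c) = 0 := by
  have hfc := hf.add_eq
  rcases hed with rfl | rfl
  · exact ⟨2, by decide, (hf.toFun_eq_zero_iff _).2 (.inr ((numOnes_eq_zero_iff _).2 (by simp)))⟩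
  · refine ⟨1, by decide, (hf.toFun_eq_zero_iff _).2 (.inr ?_)⟩
    rw [← Nat.add_zero e, hfc, ← Fintype.card_coe, numOnes_eq_card_iff]
    exact fun _ => rfl

/-! ### Unbounded layers and the absence of a basis -/

/-- In an infinite set of layers some layer lies below arbitrarily large ones. -/
theorem exists_le_unbounded_of_infinite {P : Set (ℕ × ℕ)} (hP : P.Infinite) :
    ∃ p ∈ P, ∀ N, ∃ q ∈ P, N ≤ q.1 + q.2 ∧ p.1 ≤ q.1 ∧
      (p.2 = q.2 ∨ 1 ≤ p.2 ∧ p.1 + p.2 ≤ q.2) := by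
  -- With bounded d, some fibre over d is infinite and its least e works. With unbounded d, a pair
  -- of least e among those with d ≥ 1 works.
  by_cases hb : ∃ M, ∀ p ∈ P, p.2 ≤ M
  · obtain ⟨M, hM⟩ := hb
    obtain ⟨d, -, hd⟩ : ∃ d ∈ Set.Iic M, (P ∩ Prod.snd ⁻¹' {d}).Infinite := by
      by_contra! h
      refine hP ((Set.Finite.biUnion (Set.finite_Iic M) fun d hd => h d hd).subset ?_)
      intro p hp
      exact Set.mem_biUnion (hM p hp) ⟨hp, rfl⟩
    have hinj : Set.InjOn Prod.fst (P ∩ Prod.snd ⁻¹' {d}) := fun p hp q hq h =>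
      Prod.ext h (hp.2.trans hq.2.symm)
    obtain ⟨p, hp⟩ := hd.nonempty
    obtain ⟨p, hp, hmin⟩ : ∃ p ∈ P ∩ Prod.snd ⁻¹' {d}, ∀ q ∈ P ∩ Prod.snd ⁻¹' {d}, p.1 ≤ q.1 :=
      ⟨_, Function.argminOn_mem Prod.fst _ ⟨p, hp⟩,
        fun q hq => Function.argminOn_le Prod.fst _ hq⟩
    refine ⟨p, hp.1, fun N => ?_⟩
    obtain ⟨_, ⟨q, hq, rfl⟩, hN⟩ := (hd.image hinj).exists_gt N
    exact ⟨q, hq.1, by omega, hmin q hq, .inl (hp.2.trans hq.2.symm)⟩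
  · push Not at hb
    obtain ⟨p₀, hp₀, hp₀'⟩ := hb 0
    let Q := {p ∈ P | 1 ≤ p.2}
    obtain ⟨p, hp, hmin⟩ : ∃ p ∈ Q, ∀ q ∈ Q, p.1 ≤ q.1 :=
      ⟨_, Function.argminOn_mem Prod.fst Q ⟨p₀, hp₀, hp₀'⟩,
        fun q hq => Function.argminOn_le Prod.fst Q hq⟩
    refine ⟨p, hp.1, fun N => ?_⟩
    obtain ⟨q, hq, hqN⟩ := hb (N + p.1 + p.2)
    have hp2 : 1 ≤ p.2 := hp.2
    exact ⟨q, hq, by omega, hmin q ⟨hq, by omega⟩, .inr ⟨hp2, by omega⟩⟩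

/-- If, up to a finite set `C` of auxiliary functions, elements of `F` are always generated by
single elements of large arity, and almost all of them are generated by elements of `F` of
arbitrarily large arity, then `[F]` has no basis. -/
theorem not_isBasis_of_absorbing {F C : Set Fn} (hC : C.Finite) (hCF : C ⊆ closure F)
    (hne : ∀ N, ∃ f ∈ F, N ≤ f.vars.card)
    (hsingle : ∀ A ⊆ closure F, ∀ f ∈ F, f ∈ closure A →
      ∃ a ∈ A, f.vars.card ≤ a.vars.card ∧ f ∈ closure (insert a C))
    (hbdd : {f ∈ F | ¬ ∀ N, ∃ g ∈ F, N ≤ g.vars.card ∧ f ∈ closure (insert g C)}.Finite)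
    (A : Set Fn) : ¬ IsBasis A (closure F) := by
  rintro ⟨hAF, hA, hmin⟩
  have hFA : F ⊆ closure A := hA ▸ subset_closure F
  obtain ⟨A₀, hA₀, hA₀fin, hA₀cl⟩ := exists_finite_subset_subset_closure (A := A)
    (hbdd.union hC) (Set.union_subset (fun f hf => hFA hf.1) (hCF.trans hA.symm.subset))
  have hinf : A.Infinite := by
    intro hfin
    obtain ⟨N, hN⟩ := (hfin.image fun a => a.vars.card).bddAbove
    obtain ⟨f, hf, hfN⟩ := hne (N + 1)
    obtain ⟨a, ha, hfa, -⟩ := hsingle A hAF f hf (hFA hf)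
    have := hN (Set.mem_image_of_mem _ ha)
    omega
  obtain ⟨a, haA, haA₀⟩ := (hinf.sdiff hA₀fin).nonempty
  have hsub : A₀ ⊆ A \ {a} := fun x hx => ⟨hA₀ hx, fun h => haA₀ (h ▸ hx)⟩
  have hCa : C ⊆ closure (A \ {a}) := fun f hf => closure_mono hsub (hA₀cl (.inr hf))
  refine hmin (A \ {a}) ⟨Set.sdiff_subset, fun h => (h haA).2 rfl⟩
    (Set.Subset.antisymm ((closure_mono Set.sdiff_subset).trans hA.subset)
      (closure_subset_closure fun f hf => ?_))
  by_cases hfb : ∀ N, ∃ g ∈ F, N ≤ g.vars.card ∧ f ∈ closure (insert g C)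
  -- Arity above that of `a` forces the single generator `b` of `g` to differ from `a`.
  · obtain ⟨g, hg, hgN, hfg⟩ := hfb (a.vars.card + 1)
    obtain ⟨b, hb, hgb, hgcl⟩ := hsingle A hAF g hg (hFA hg)
    have hba : b ≠ a := by
      rintro rfl
      omega
    have hbC : insert b C ⊆ closure (A \ {a}) :=
      Set.insert_subset (subset_closure _ ⟨hb, hba⟩) hCa
    exact closure_subset_closure
      (Set.insert_subset (closure_subset_closure hbC hgcl) hCa) hfg
  · exact closure_mono hsub (hA₀cl (.inl ⟨hf, hfb⟩))

theorem not_isBasis_of_infinite {F : Set Fn} (hF : F ⊆ SMinusOne)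
    (hcong : F.Pairwise fun f g => ¬ Congruent f g) (hinf : F.Infinite) (A : Set Fn) :
    ¬ IsBasis A (closure F) := by
  choose! e d hl using fun f (hf : f ∈ F) => exists_omitsLayer (hF hf)
  have hstrict : ∀ g ∈ F, g.Strict := fun g hg => (hl g hg).strict
  have hinj : Set.InjOn (fun f => (e f, d f)) F := by
    intro f hf g hg h
    by_contra hne
    obtain ⟨h1, h2⟩ := Prod.mk.inj h
    have hlg := hl g hg
    rw [← h1, ← h2] at hlg
    exact hcong hf hg hne ((hl f hf).congruent hlg)
  have hunb : ∀ S ⊆ F, S.Infinite → ∃ f ∈ S, ∀ N, ∃ g ∈ S, N ≤ g.vars.card ∧ e f ≤ e g ∧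
      (d f = d g ∨ 1 ≤ d f ∧ e f + d f ≤ d g) := by
    intro S hS hSinf
    obtain ⟨_, ⟨f, hf, rfl⟩, h⟩ :=
      exists_le_unbounded_of_infinite (hSinf.image (hinj.mono hS))
    refine ⟨f, hf, fun N => ?_⟩
    obtain ⟨_, ⟨g, hg, rfl⟩, hN, h⟩ := h N
    exact ⟨g, hg, (hl g (hS hg)).add_eq ▸ hN, h⟩
  have hne : ∀ N, ∃ f ∈ F, N ≤ f.vars.card := by
    obtain ⟨f, -, h⟩ := hunb F subset_rfl hinf
    intro N
    obtain ⟨g, hg, hN, -⟩ := h N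
    exact ⟨g, hg, hN⟩
  have hbdd : ∀ C : Set Fn, (∀ g ∈ C, g.Strict) →
      (allNonzero ∈ C ∨ ∀ f ∈ F, e f = 0 ∨ d f = 0) →
      {f ∈ F | ¬ ∀ N, ∃ g ∈ F, N ≤ g.vars.card ∧ f ∈ closure (insert g C)}.Finite := by
    intro C hC hC'
    by_contra hB
    -- Applied inside the exceptional set, the order lemma yields a member that is absorbed after
    -- all.
    obtain ⟨f, hf, h⟩ := hunb _ (Set.sep_subset _ _) hB
    refine hf.2 fun N => ?_
    obtain ⟨g, hg, hN, hefg, hdfg⟩ := h N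
    refine ⟨g, hg.1, hN, mem_closure_of_omitsLayer ?_ (hl f hf.1) (hl g hg.1)
      (Set.mem_insert _ _) hefg hdfg (hC'.imp (fun h => Set.mem_insert_of_mem _ h) fun h => ?_)⟩
    · rintro k (rfl | hk)
      exacts [hstrict _ hg.1, hC k hk]
    · have h1 := h f hf.1
      have h2 := h g hg.1
      have h3 := (hl f hf.1).add_eq
      have h4 := f.vars_nonempty.card_pos
      omega
  by_cases hT : ∃ f ∈ F, 1 ≤ e f ∧ 1 ≤ d f
  · obtain ⟨f, hf, hef, hdf⟩ := hT
    refine not_isBasis_of_absorbing (C := {allNonzero}) (Set.finite_singleton _)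
      (Set.singleton_subset_iff.2 (allNonzero_mem_closure hstrict hf (hl f hf) hef hdf)) hne
      (fun A hA f hf hfA => ?_)
      (hbdd _ (fun g hg => hg ▸ strict_allNonzero) (.inl rfl)) A
    exact exists_mem_closure_pair (fun g hg => strict_of_mem_closure hstrict (hA hg))
      (hl f hf) hfA
  · have hed : ∀ f ∈ F, e f = 0 ∨ d f = 0 := fun f hf => by
      by_contra h
      exact hT ⟨f, hf, by omega, by omega⟩
    refine not_isBasis_of_absorbing (C := ∅) Set.finite_empty (Set.empty_subset _) hne
      (fun A hA f hf hfA => ?_) (hbdd _ (fun g hg => hg.elim) (.inr hed)) A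
    have h := exists_mem_closure_singleton (fun g hg => strict_of_mem_closure hstrict (hA hg))
      (fun g hg => exists_const_zero_of_mem_closure hstrict
        (fun k hk => exists_const_zero_of_omitsLayer (hl k hk) (hed k hk)) (hA hg))
      (hl f hf) (hed f hf) hfA
    simpa using h

end ThreeValued

theorem theorem2 (F : Set ThreeValued.Fn) (hF : F ⊆ ThreeValued.SMinusOne)
    (hcong : F.Pairwise fun f g => ¬ ThreeValued.Congruent f g)
    (G : Set ThreeValued.Fn) (hG : G = ThreeValued.closure F) :
    ((∃ A : Set ThreeValued.Fn, A.Finite ∧ ThreeValued.IsBasis A G) ↔ F.Finite) ∧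
    ((¬ ∃ A : Set ThreeValued.Fn, ThreeValued.IsBasis A G) ↔ F.Infinite) := by
  subst hG
  have hfin := fun h : F.Finite => ThreeValued.exists_finite_isBasis_of_finite h
  have hinf := ThreeValued.not_isBasis_of_infinite hF hcong
  refine ⟨⟨fun ⟨A, _, hA⟩ => ?_, hfin⟩, fun h hF' => ?_, fun h ⟨A, hA⟩ => hinf h A hA⟩
  · by_contra h
    exact hinf h A hA
  · obtain ⟨A, -, hA⟩ := hfin hF'
    exact h ⟨A, hA⟩
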